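/- A topological J-group is a Hausdorff topological group $G$ for which there exist an element $w\in G$ and a continuous map $f\colon G\to G$ (not necessarily a homomorphism) such that $f(xw)=f(x)\,x$ for all $x\in G$. Let $G$ be an abelian profinite group, i.e. a compact Hausdorff totally disconnected abelian topological group. (a) If $G$ is torsion-free, then $G$ is a topological J-group. Moreover, $G$ is then isomorphic, as a topological group, to a product $\prod_{p}\mathbb{Z}_p^{I_p}$, where $p$ ranges over all prime numbers, each $I_p$ is a (possibly empty, possibly infinite) index set, $\mathbb{Z}_p$ is the additive topological group of $p$-adic integers, and the product carries the product topology. (b) If every element of $G$ has finite order, then $G$ is a topological J-group if and only if the order of every element of $G$ is odd. -/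

import Mathlib

/-- `(G, w, f)` is a topological J-group: `G` is a Hausdorff topological group, `w` is an element
of `G` (the witness) and `f` is a continuous self-map of `G` with `f (x * w) = f x * x`. -/
structure IsTopologicalJTriple (G : Type*) [Group G] [TopologicalSpace G] (w : G) (f : G → G) :
    Prop where
  t2Space : T2Space G
  isTopologicalGroup : IsTopologicalGroup G
  continuous_map : Continuous f
  map_mul_witness : ∀ x : G, f (x * w) = f x * x

/-- `G` is a topological J-group if `(G, w, f)` is one for some witness `w` and some map `f`. -/
def IsTopologicalJGroup (G : Type*) [Group G] [TopologicalSpace G] : Prop :=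
  ∃ (w : G) (f : G → G), IsTopologicalJTriple G w f

/-- Elements of `Nat.Primes` are prime, so that `ℤ_[p]` makes sense for them. -/
instance fact_prime_of_primes (p : Nat.Primes) : Fact (Nat.Prime (p : ℕ)) := ⟨p.2⟩

universe u

/-!
# Abelian profinite J-groups

The structure theorem for a torsion-free profinite abelian group `A` is proved with characters.
Multiplication by `n` is a closed embedding of `A`, so injectivity of `ℚ / ℤ` makes the group of
continuous `ℚ / ℤ`-valued characters divisible (`exists_nsmul_character_eq`). Dividing repeatedly
by `p`, one lifts every continuous homomorphism `A → ZMod p` to `A → ℤ_[p]`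
(`exists_padicInt_lift`). For each prime `p`, take a basis `I p` of the space of continuous
homomorphisms `A → ZMod p`; the lifts of its elements are the coordinates of a map
`Φ : A → ∏ p, ℤ_[p] ^ I p`. Modulo `p` it is the isomorphism `A / p A ≃ (ZMod p) ^ I p` given by
the basis (`exists_nsmul_eq_of_forall_zmod_hom`, `exists_zmod_hom_basis`). Hence the kernel of `Φ`
is divisible, so it vanishes, and the closed image `H` satisfies `H + p T = T` in the target `T`
for all `p`, so it is everything. On the product of the `ℤ_[p]`, the map `f x = x (x - 1) / 2` and
the witness `1` give a J-group.

For torsion groups, iterating `f (x w) = f x * x` along the order `n` of `w` gives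
`x ^ n * w ^ (n (n - 1) / 2) = 1`, which forces `n` to be odd and to annihilate the group
(`odd_orderOf_of_map_mul_witness`). Conversely, a profinite torsion group has finite exponent `m`
by Baire's theorem. If all orders are odd, so is `m`; an element `w` of order `m` has
a coordinate `π : G → ZMod m` with `π w = 1`, again by extension of characters, and
`f x = π x • x - (π x (π x + 1) / 2) • w` works, `2` being invertible modulo `m`.
-/

open Topology

/-! ### Characters with values in `ℚ / ℤ` -/

/-- The homomorphism `ZMod N → ℚ / ℤ` sending `1` to `1 / N`. It is injective for `N ≠ 0`, and zero
for `N = 0`. -/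
noncomputable def zmodToAddCircle (N : ℕ) : ZMod N →+ AddCircle (1 : ℚ) :=
  ZMod.lift N ⟨zmultiplesHom _ (((1 / N : ℚ) : ℚ) : AddCircle (1 : ℚ)), by
    rcases eq_or_ne N 0 with rfl | hN
    · simp
    · have hN' : (N : ℚ) ≠ 0 := by exact_mod_cast hN
      have h := AddCircle.coe_period (1 : ℚ)
      rw [zmultiplesHom_apply, ← AddCircle.coe_zsmul, ← h]
      congr 1
      simp [hN']⟩

lemma zmodToAddCircle_intCast (N : ℕ) (k : ℤ) :
    zmodToAddCircle N k = ((k / N : ℚ) : AddCircle (1 : ℚ)) := by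
  rw [zmodToAddCircle, ZMod.lift_coe]
  simp only [zmultiplesHom_apply, ← AddCircle.coe_zsmul]
  congr 1
  rw [zsmul_eq_mul, mul_one_div]

lemma zmodToAddCircle_injective {N : ℕ} (hN : N ≠ 0) :
    Function.Injective (zmodToAddCircle N) := by
  rw [injective_iff_map_eq_zero]
  intro a ha
  obtain ⟨k, rfl⟩ := ZMod.intCast_surjective a
  rw [zmodToAddCircle_intCast, AddCircle.coe_eq_zero_iff] at ha
  obtain ⟨n, hn⟩ := ha
  have hN' : (N : ℚ) ≠ 0 := by exact_mod_cast hN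
  rw [ZMod.intCast_zmod_eq_zero_iff_dvd]
  refine ⟨n, ?_⟩
  have : (k : ℚ) = N * n := by
    rw [zsmul_eq_mul, mul_one] at hn
    rw [hn]; field_simp
  exact_mod_cast this

lemma exists_zmodToAddCircle_eq {N : ℕ} (hN : N ≠ 0) {t : AddCircle (1 : ℚ)} (ht : N • t = 0) :
    ∃ a, zmodToAddCircle N a = t := by
  obtain ⟨q, rfl⟩ := QuotientAddGroup.mk_surjective t
  change N • ((q : ℚ) : AddCircle (1 : ℚ)) = 0 at ht
  rw [← AddCircle.coe_nsmul, AddCircle.coe_eq_zero_iff] at ht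
  obtain ⟨n, hn⟩ := ht
  have hN' : (N : ℚ) ≠ 0 := by exact_mod_cast hN
  refine ⟨n, ?_⟩
  rw [zmodToAddCircle_intCast]
  have : (n / N : ℚ) = q := by
    rw [zsmul_eq_mul, mul_one, nsmul_eq_mul] at hn
    rw [hn]; field_simp
  rw [this]

lemma zmodToAddCircle_castHom {p : ℕ} (hp : p ≠ 0) (n : ℕ) (a : ZMod (p ^ (n + 1))) :
    zmodToAddCircle (p ^ n) (ZMod.castHom (pow_dvd_pow p n.le_succ) (ZMod (p ^ n)) a) =
      p • zmodToAddCircle (p ^ (n + 1)) a := by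
  obtain ⟨k, rfl⟩ := ZMod.intCast_surjective a
  have hp' : (p : ℚ) ≠ 0 := by exact_mod_cast hp
  rw [map_intCast, zmodToAddCircle_intCast, zmodToAddCircle_intCast, ← AddCircle.coe_nsmul]
  congr 1
  rw [nsmul_eq_mul]
  push_cast
  field_simp
  ring

section ProfiniteCharacters

variable {A : Type*} [AddCommGroup A]

/-- A `ℚ / ℤ`-valued character annihilated by `N` comes from a homomorphism to `ZMod N`. -/
lemma exists_zmod_lift {N : ℕ} (hN : N ≠ 0) (χ : A →+ AddCircle (1 : ℚ))
    (h : ∀ x, N • χ x = 0) : ∃ φ : A →+ ZMod N, ∀ x, zmodToAddCircle N (φ x) = χ x := by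
  choose φ hφ using fun x ↦ exists_zmodToAddCircle_eq hN (h x)
  refine ⟨AddMonoidHom.mk' φ fun x y ↦ zmodToAddCircle_injective hN ?_, hφ⟩
  rw [map_add, hφ, hφ, hφ, map_add]

/-- Extension of characters along `i : K → A` with control of the kernel: this is injectivity of
`ℚ / ℤ`, applied to `K ⧸ i⁻¹ V → A ⧸ V`. When `V` is an open subgroup of a topological group, the
extension is continuous. -/
lemma exists_character_extension {K : Type*} [AddCommGroup K] (i : K →+ A) (V : AddSubgroup A)
    (c : K →+ AddCircle (1 : ℚ)) (hc : ∀ k, i k ∈ V → c k = 0) :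
    ∃ χ : A →+ AddCircle (1 : ℚ), (∀ k, χ (i k) = c k) ∧ ∀ v ∈ V, χ v = 0 := by
  let f : K ⧸ V.comap i →+ A ⧸ V := QuotientAddGroup.map _ _ i le_rfl
  have hf : Function.Injective f.toIntLinearMap := by
    change Function.Injective f
    rw [injective_iff_map_eq_zero]
    intro k
    obtain ⟨k, rfl⟩ := QuotientAddGroup.mk_surjective k
    intro hk
    rw [QuotientAddGroup.eq_zero_iff]
    exact (QuotientAddGroup.eq_zero_iff (i k)).1 hk
  obtain ⟨χ, hχ⟩ := CharacterModule.dual_surjective_of_injective f.toIntLinearMap hf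
    (QuotientAddGroup.lift (V.comap i) c hc : K ⧸ V.comap i →+ AddCircle (1 : ℚ))
  refine ⟨AddMonoidHom.comp χ (QuotientAddGroup.mk' V), fun k ↦ ?_, fun v hv ↦ ?_⟩
  · exact congr($hχ (k : K ⧸ V.comap i))
  · have : QuotientAddGroup.mk' V v = 0 := (QuotientAddGroup.eq_zero_iff v).2 hv
    change χ (QuotientAddGroup.mk' V v) = 0
    rw [this, map_zero]

/-! ### Open subgroups of profinite abelian groups -/

variable [TopologicalSpace A] [IsTopologicalAddGroup A]

lemma AddMonoidHom.continuous_of_isOpen_le_ker {B : Type*} [AddCommGroup B] [TopologicalSpace B]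
    [IsTopologicalAddGroup B] (φ : A →+ B) {V : AddSubgroup A} (hV : IsOpen (V : Set A))
    (h : ∀ v ∈ V, φ v = 0) : Continuous φ := by
  refine continuous_of_continuousAt_zero φ ?_
  refine Filter.Tendsto.congr' (f₁ := fun _ ↦ (0 : B)) ?_ (by simp [tendsto_const_nhds])
  filter_upwards [hV.mem_nhds V.zero_mem] with v hv using (h v hv).symm

variable [CompactSpace A] [TotallyDisconnectedSpace A]

lemma exists_isOpen_addSubgroup_subset {W : Set A} (hW : W ∈ 𝓝 (0 : A)) :
    ∃ V : AddSubgroup A, IsOpen (V : Set A) ∧ (V : Set A) ⊆ W := by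
  obtain ⟨U, hUW, hU, h0⟩ := mem_nhds_iff.1 hW
  obtain ⟨V, hV⟩ := ProfiniteGrp.exist_openNormalAddSubgroup_sub_open_nhds_of_zero hU h0
  exact ⟨V.toAddSubgroup, V.isOpen', hV.trans hUW⟩

/-- Closed subgroups of profinite abelian groups are separated from points by open subgroups. -/
lemma exists_isOpen_le_notMem {H : AddSubgroup A} (hH : IsClosed (H : Set A)) {x : A}
    (hx : x ∉ H) : ∃ V : AddSubgroup A, IsOpen (V : Set A) ∧ H ≤ V ∧ x ∉ V := by
  have h := ProfiniteGrp.closedAddSubgroup_eq_sInf_open (G := A) ⟨H, hH⟩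
  change H = _ at h
  rw [h, AddSubgroup.mem_sInf] at hx
  push Not at hx
  obtain ⟨V, ⟨hV, hHV⟩, hxV⟩ := hx
  exact ⟨V, hV, hHV, hxV⟩

/-- A closed subgroup `H` of a profinite abelian group with `H + p A = A` for all primes `p` is
everything: otherwise a proper open subgroup contains `H`, and multiplication by some prime
is not surjective on the corresponding nontrivial finite quotient. -/
lemma AddSubgroup.eq_top_of_forall_prime {H : AddSubgroup A} (hH : IsClosed (H : Set A))
    (h : ∀ p : ℕ, p.Prime → ∀ x : A, ∃ y, x - p • y ∈ H) : H = ⊤ := by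
  by_contra hne
  obtain ⟨x, hx⟩ : ∃ x, x ∉ H := by
    by_contra! hall
    exact hne (eq_top_iff.2 fun x _ ↦ hall x)
  obtain ⟨V, hV, hHV, hxV⟩ := exists_isOpen_le_notMem hH hx
  have : Finite (A ⧸ V) := V.quotient_finite_of_isOpen hV
  have : Nontrivial (A ⧸ V) :=
    ⟨⟨x, 0, fun h0 ↦ hxV ((QuotientAddGroup.eq_zero_iff x).1 h0)⟩⟩
  obtain ⟨p, hp, hdvd⟩ := Nat.exists_prime_and_dvd (Finite.one_lt_card (α := A ⧸ V)).ne'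
  have : Fact p.Prime := ⟨hp⟩
  have hsurj : Function.Surjective fun y : A ⧸ V ↦ p • y := by
    intro x
    obtain ⟨x, rfl⟩ := QuotientAddGroup.mk_surjective x
    obtain ⟨y, hy⟩ := h p hp x
    refine ⟨(y : A ⧸ V), ?_⟩
    have := (QuotientAddGroup.eq_zero_iff (x - p • y)).2 (hHV hy)
    rw [QuotientAddGroup.mk_sub, sub_eq_zero] at this
    exact this.symm
  obtain ⟨a, ha⟩ := exists_prime_addOrderOf_dvd_card' p hdvd
  have h0 : a = 0 := (Finite.injective_iff_surjective.2 hsurj) <| by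
    simp [← ha, addOrderOf_nsmul_eq_zero]
  rw [h0, addOrderOf_zero] at ha
  exact hp.one_lt.ne ha

/-- A profinite abelian group has no nonzero divisible subgroups: its finite
quotients have none. -/
lemma AddSubgroup.eq_bot_of_forall_prime {K : AddSubgroup A}
    (h : ∀ p : ℕ, p.Prime → ∀ x ∈ K, ∃ y ∈ K, p • y = x) : K = ⊥ := by
  have hn : ∀ n : ℕ, n ≠ 0 → ∀ x ∈ K, ∃ y ∈ K, n • y = x := by
    intro n
    induction n using Nat.recOnMul with
    | zero => exact fun h0 ↦ absurd rfl h0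
    | one => exact fun _ x hx ↦ ⟨x, hx, one_nsmul x⟩
    | prime p hp => exact fun _ ↦ h p hp
    | mul a b iha ihb =>
      intro hab x hx
      obtain ⟨y, hy, rfl⟩ := iha (left_ne_zero_of_mul hab) x hx
      obtain ⟨z, hz, rfl⟩ := ihb (right_ne_zero_of_mul hab) y hy
      exact ⟨z, hz, mul_nsmul' z a b⟩
  rw [AddSubgroup.eq_bot_iff_forall]
  intro x hx
  by_contra hne
  obtain ⟨V, hV, -, hxV⟩ := exists_isOpen_le_notMem (H := (⊥ : AddSubgroup A)) (x := x)
    (by simp) (by simpa using hne)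
  have : Finite (A ⧸ V) := V.quotient_finite_of_isOpen hV
  obtain ⟨y, -, rfl⟩ := hn (Nat.card (A ⧸ V)) Nat.card_pos.ne' x hx
  refine hxV ((QuotientAddGroup.eq_zero_iff _).1 ?_)
  rw [QuotientAddGroup.mk_nsmul]
  exact card_nsmul_eq_zero'

/-! ### Characters modulo a prime -/

variable [T2Space A]

/-- The elements of `p A` are detected by the continuous homomorphisms to `ZMod p`. -/
lemma exists_nsmul_eq_of_forall_zmod_hom {p : ℕ} (hp : p ≠ 0) {x : A}
    (h : ∀ χ : A →ₜ+ ZMod p, χ x = 0) : ∃ y : A, p • y = x := by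
  by_contra hx
  have hcont : Continuous fun y : A ↦ p • y := continuous_const_smul p
  obtain ⟨V, hV, hpV, hxV⟩ := exists_isOpen_le_notMem
    (H := (nsmulAddMonoidHom p : A →+ A).range) (x := x)
    (isCompact_range hcont).isClosed hx
  have hne : (x : A ⧸ V) ≠ 0 := fun h0 ↦ hxV ((QuotientAddGroup.eq_zero_iff x).1 h0)
  obtain ⟨c, hc⟩ := CharacterModule.exists_character_apply_ne_zero_of_ne_zero hne
  have hcV : ∀ v ∈ V, c (v : A ⧸ V) = 0 := fun v hv ↦ by
    rw [(QuotientAddGroup.eq_zero_iff v).2 hv, map_zero]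
  obtain ⟨φ, hφ⟩ := exists_zmod_lift hp (AddMonoidHom.comp c (QuotientAddGroup.mk' V)) fun y ↦ by
    rw [← map_nsmul]
    exact hcV _ (hpV ⟨y, rfl⟩)
  have hker : ∀ v ∈ V, φ v = 0 := fun v hv ↦ zmodToAddCircle_injective hp <| by
    rw [hφ, map_zero]
    exact hcV v hv
  have h0 := h ⟨φ, φ.continuous_of_isOpen_le_ker hV hker⟩
  change φ x = 0 at h0
  apply hc
  have := hφ x
  rw [h0, map_zero] at this
  exact this.symm

omit [IsTopologicalAddGroup A] [TotallyDisconnectedSpace A] [T2Space A] in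
/-- A basis of a `ZMod p`-vector space `D` of continuous homomorphisms `A → ZMod p`, with evaluation
map `e`: it detects the common kernel of `D`, and by compactness its elements can be given
arbitrary values simultaneously. -/
lemma exists_basis_of_continuous_pairing {p : ℕ} [Fact p.Prime] {D : Type*} [AddCommGroup D]
    (e : D →+ A →+ ZMod p) (he : Function.Injective e) (hc : ∀ d, Continuous (e d)) :
    ∃ I : Set D, (∀ x, (∀ d ∈ I, e d x = 0) → ∀ d, e d x = 0) ∧
      ∀ v : I → ZMod p, ∃ x, ∀ d : I, e d.1 x = v d := by
  have : Module (ZMod p) D := AddCommGroup.zmodModule fun d ↦ he <| AddMonoidHom.ext fun x ↦ by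
    rw [map_nsmul, map_zero, AddMonoidHom.nsmul_apply, AddMonoidHom.zero_apply, nsmul_eq_mul,
      CharP.cast_eq_zero, zero_mul]
  let ev (x : A) : D →ₗ[ZMod p] ZMod p := (e.flip x).toZModLinearMap p
  have hev (x : A) (d : D) : ev x d = e d x := rfl
  let b := Module.Basis.ofVectorSpace (ZMod p) D
  refine ⟨Module.Basis.ofVectorSpaceIndex (ZMod p) D, fun x hx χ ↦ ?_, fun v ↦ ?_⟩
  · have : ev x = 0 := b.ext fun i ↦ by
      rw [Module.Basis.ofVectorSpace_apply_self, hev, LinearMap.zero_apply]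
      exact hx _ i.2
    rw [← hev, this, LinearMap.zero_apply]
  · classical
    have hfin (S : Finset (Module.Basis.ofVectorSpaceIndex (ZMod p) D)) :
        ∃ x : A, ∀ i ∈ S, e i x = v i := by
      let r : A →+ (S → ZMod p) :=
        { toFun x i := e i.1 x, map_zero' := by ext; simp, map_add' _ _ := by ext; simp }
      have hr : AddSubgroup.toZModSubmodule p r.range = ⊤ := by
        by_contra hne
        obtain ⟨φ, hφ, hker⟩ := Submodule.exists_le_ker_of_lt_top _ (lt_top_iff_ne_top.2 hne)
        refine hφ (LinearMap.pi_ext' fun i ↦ LinearMap.ext_ring ?_)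
        -- `φ` gives a linear relation between the basis elements in `S`
        have hsum : ∑ i : S, φ (Pi.single i 1) • b i.1 = 0 := by
          refine he (AddMonoidHom.ext fun x ↦ ?_)
          rw [← hev, map_sum, map_zero, AddMonoidHom.zero_apply]
          have h0 : φ (r x) = 0 := hker ⟨x, rfl⟩
          rw [← Finset.univ_sum_single (r x), map_sum] at h0
          rw [← h0]
          refine Finset.sum_congr rfl fun i _ ↦ ?_
          have : (Pi.single i (r x i) : S → ZMod p) = r x i • Pi.single i 1 := by
            rw [← Pi.single_smul, smul_eq_mul, mul_one]
          rw [this, map_smul, map_smul, smul_eq_mul, smul_eq_mul, mul_comm, hev,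
            Module.Basis.ofVectorSpace_apply_self]
          rfl
        have hli := b.linearIndependent.comp (fun i : S ↦ i.1) Subtype.val_injective
        exact Fintype.linearIndependent_iff.1 hli _ hsum i
      have hv : (fun i : S ↦ v i.1) ∈ AddSubgroup.toZModSubmodule p r.range := by
        rw [hr]; trivial
      obtain ⟨x, hx⟩ := hv
      exact ⟨x, fun i hi ↦ congr($hx ⟨i, hi⟩)⟩
    obtain ⟨x, -, hx⟩ := (isCompact_univ (X := A)).inter_iInter_nonempty
      (fun i : Module.Basis.ofVectorSpaceIndex (ZMod p) D ↦ {x : A | e i x = v i})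
      (fun i ↦ isClosed_eq (hc i.1) continuous_const) fun S ↦ by
        obtain ⟨x, hx⟩ := hfin S
        exact ⟨x, trivial, by simpa using hx⟩
    exact ⟨x, fun i ↦ Set.mem_iInter.1 hx i⟩

omit [IsTopologicalAddGroup A] [TotallyDisconnectedSpace A] [T2Space A] in
/-- When `A` is profinite, the homomorphisms `χ ∈ I` are the coordinates of an isomorphism
`A ⧸ p A ≃ (ZMod p) ^ I`, by `exists_nsmul_eq_of_forall_zmod_hom`. -/
lemma exists_zmod_hom_basis (p : ℕ) [Fact p.Prime] :
    ∃ I : Set (A →ₜ+ ZMod p),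
      (∀ x, (∀ χ ∈ I, χ x = 0) → ∀ χ : A →ₜ+ ZMod p, χ x = 0) ∧
      ∀ v : I → ZMod p, ∃ x, ∀ χ : I, χ.1 x = v χ := by
  exact exists_basis_of_continuous_pairing (D := A →ₜ+ ZMod p)
    { toFun χ := (χ : A →+ ZMod p), map_zero' := rfl, map_add' _ _ := rfl }
    ContinuousAddMonoidHom.toAddMonoidHom_injective fun χ ↦ map_continuous χ

/-! ### Lifting characters of torsion-free groups to `ℤ_[p]` -/

variable [IsAddTorsionFree A]

/-- The group of continuous `ℚ / ℤ`-valued characters of a torsion-free profinite abelian group is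
divisible: the character `n • x ↦ χ x` of `n A` is continuous because multiplication by `n` is a
closed embedding, and it extends to `A`. -/
lemma exists_nsmul_character_eq {n : ℕ} (hn : n ≠ 0) (χ : A →+ AddCircle (1 : ℚ))
    (hχ : ∃ U : AddSubgroup A, IsOpen (U : Set A) ∧ ∀ u ∈ U, χ u = 0) :
    ∃ ψ : A →+ AddCircle (1 : ℚ),
      (∃ V : AddSubgroup A, IsOpen (V : Set A) ∧ ∀ v ∈ V, ψ v = 0) ∧ ∀ x, n • ψ x = χ x := by
  obtain ⟨U, hU, hχU⟩ := hχ
  have hemb : IsClosedEmbedding fun x : A ↦ n • x :=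
    (continuous_const_smul n).isClosedEmbedding (nsmul_right_injective hn)
  have hU0 : (U : Set A) ∈ 𝓝 (0 : A) := hU.mem_nhds U.zero_mem
  rw [hemb.isInducing.nhds_eq_comap, smul_zero, Filter.mem_comap] at hU0
  obtain ⟨W, hW, hWU⟩ := hU0
  obtain ⟨V, hV, hVW⟩ := exists_isOpen_addSubgroup_subset hW
  obtain ⟨ψ, hψ, hψV⟩ := exists_character_extension (nsmulAddMonoidHom n) V χ
    fun k hk ↦ hχU k (hWU (hVW hk))
  exact ⟨ψ, ⟨V, hV, hψV⟩, fun x ↦ by rw [← map_nsmul]; exact hψ x⟩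

/-- A continuous homomorphism from a torsion-free profinite abelian group to `ZMod p` lifts to
`ℤ_[p]`: divide the corresponding `ℚ / ℤ`-valued character repeatedly by `p`. -/
lemma exists_padicInt_lift {p : ℕ} [hp : Fact p.Prime] (χ : A →ₜ+ ZMod p) :
    ∃ φ : A →ₜ+ ℤ_[p], ∀ x, PadicInt.toZMod (φ x) = χ x := by
  let C := {ψ : A →+ AddCircle (1 : ℚ) //
    ∃ U : AddSubgroup A, IsOpen (U : Set A) ∧ ∀ u ∈ U, ψ u = 0}
  let ψ₀ : C := ⟨(zmodToAddCircle p).comp (χ : A →+ ZMod p), (χ : A →+ ZMod p).ker,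
    (isOpen_discrete {(0 : ZMod p)}).preimage (map_continuous χ), fun u hu ↦ by
      have hu' : χ u = 0 := hu
      change zmodToAddCircle p (χ u) = 0
      rw [hu', map_zero]⟩
  have hstep (ψ : C) : ∃ ψ' : C, ∀ x, p • ψ'.1 x = ψ.1 x := by
    obtain ⟨ψ', hψ', h⟩ := exists_nsmul_character_eq hp.out.ne_zero ψ.1 ψ.2
    exact ⟨⟨ψ', hψ'⟩, h⟩
  choose next hnext using hstep
  let Y (n : ℕ) : C := next^[n] ψ₀
  have hY (n : ℕ) (x : A) : p • (Y (n + 1)).1 x = (Y n).1 x := by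
    simp only [Y, Function.iterate_succ_apply', hnext]
  have hYp (n : ℕ) (x : A) : p ^ (n + 1) • (Y n).1 x = 0 := by
    induction n with
    | zero =>
      change p ^ 1 • zmodToAddCircle p (χ x) = 0
      rw [pow_one, ← map_nsmul]
      simp
    | succ n ih => rw [pow_succ, mul_nsmul', hY, ih]
  -- `p • Y n` is annihilated by `p ^ n`, and `p • Y 1` is the character of `χ`
  have hk (n : ℕ) (x : A) :
      ∃ k : ℤ, zmodToAddCircle (p ^ n) k = p • (Y n).1 x := by
    obtain ⟨a, ha⟩ := exists_zmodToAddCircle_eq (N := p ^ n) (pow_ne_zero n hp.out.ne_zero)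
      (t := p • (Y n).1 x) (by rw [← mul_nsmul', ← pow_succ, hYp])
    obtain ⟨k, rfl⟩ := ZMod.intCast_surjective a
    exact ⟨k, ha⟩
  choose k hk using hk
  have hdvd (x : A) (n : ℕ) : (p : ℤ) ^ n ∣ k (n + 1) x - k n x := by
    have h : zmodToAddCircle (p ^ n) (k (n + 1) x : ℤ) = zmodToAddCircle (p ^ n) (k n x : ℤ) := by
      rw [hk n x, ← hY n x, ← hk (n + 1) x, ← zmodToAddCircle_castHom hp.out.ne_zero]
      simp
    have := zmodToAddCircle_injective (pow_ne_zero n hp.out.ne_zero) h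
    rw [eq_comm, ZMod.intCast_eq_intCast_iff_dvd_sub] at this
    exact_mod_cast this
  let z (x : A) : ℤ_[p] :=
    PadicInt.ofIntSeq _ (PadicInt.isCauSeq_padicNorm_of_pow_dvd_sub (k · x) p (hdvd x))
  have hzk (n : ℕ) (x : A) : PadicInt.toZModPow n (z x) = k n x :=
    PadicInt.toZModPow_ofIntSeq_of_pow_dvd_sub (k · x) p (hdvd x) n
  have hz (n : ℕ) (x : A) :
      zmodToAddCircle (p ^ n) (PadicInt.toZModPow n (z x)) = p • (Y n).1 x := by
    rw [hzk, hk]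
  let φ : A →+ ℤ_[p] := AddMonoidHom.mk' z fun x y ↦ PadicInt.ext_of_toZModPow.1 fun n ↦
    zmodToAddCircle_injective (pow_ne_zero n hp.out.ne_zero) <| by
      rw [map_add, map_add, hz, hz, hz, map_add, nsmul_add]
  have hφ : Continuous φ := by
    refine continuous_of_continuousAt_zero φ ?_
    rw [ContinuousAt, map_zero, NormedAddGroup.tendsto_nhds_zero]
    intro ε hε
    obtain ⟨n, hn⟩ := PadicInt.exists_pow_neg_lt p hε
    obtain ⟨U, hU, hUY⟩ := (Y n).2
    filter_upwards [hU.mem_nhds U.zero_mem] with x hx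
    refine lt_of_le_of_lt ?_ hn
    rw [PadicInt.norm_le_pow_iff_mem_span_pow, ← PadicInt.ker_toZModPow, RingHom.mem_ker]
    refine zmodToAddCircle_injective (pow_ne_zero n hp.out.ne_zero) ?_
    change zmodToAddCircle (p ^ n) (PadicInt.toZModPow n (z x)) = _
    rw [hz, hUY x hx, nsmul_zero, map_zero]
  refine ⟨⟨φ, hφ⟩, fun x ↦ ?_⟩
  change PadicInt.toZMod (z x) = χ x
  have h1 : χ x = k 1 x := zmodToAddCircle_injective hp.out.ne_zero <| by
    have h := hk 1 x
    rw [hY 0 x, zmodToAddCircle_intCast, pow_one] at h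
    rw [zmodToAddCircle_intCast, h]
    rfl
  have h2 : z x - k 1 x ∈ RingHom.ker (PadicInt.toZModPow 1 : ℤ_[p] →+* ZMod (p ^ 1)) := by
    rw [RingHom.mem_ker, map_sub, hzk, map_intCast, sub_self]
  rw [PadicInt.ker_toZModPow, pow_one, ← PadicInt.maximalIdeal_eq_span_p, ← PadicInt.ker_toZMod,
    RingHom.mem_ker, map_sub, map_intCast, sub_eq_zero] at h2
  rw [h2, h1]

end ProfiniteCharacters

/-! ### The structure of torsion-free profinite abelian groups -/

/-- A torsion-free profinite abelian group is a product of groups of `p`-adic integers. The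
coordinates are lifts to `ℤ_[p]` of the elements of a basis of the continuous homomorphisms to
`ZMod p`. -/
theorem exists_continuousAddEquiv_pi_padicInt (A : Type u) [AddCommGroup A] [TopologicalSpace A]
    [IsTopologicalAddGroup A] [CompactSpace A] [TotallyDisconnectedSpace A] [T2Space A]
    [IsAddTorsionFree A] :
    ∃ I : Nat.Primes → Type u, Nonempty (A ≃ₜ+ ((p : Nat.Primes) → I p → ℤ_[(p : ℕ)])) := by
  choose I hI hIv using fun p : Nat.Primes ↦ exists_zmod_hom_basis (A := A) (p : ℕ)
  choose φ hφ using fun (p : Nat.Primes) (χ : I p) ↦ exists_padicInt_lift χ.1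
  refine ⟨fun p ↦ I p, ?_⟩
  let Φ : A →+ ((p : Nat.Primes) → I p → ℤ_[(p : ℕ)]) :=
    { toFun x p χ := φ p χ x
      map_zero' := by ext; simp
      map_add' _ _ := by funext p χ; exact map_add _ _ _ }
  have hΦ : Continuous Φ :=
    continuous_pi fun p ↦ continuous_pi fun χ ↦ map_continuous (φ p χ)
  have hinj : Function.Injective Φ := by
    rw [← AddMonoidHom.ker_eq_bot_iff]
    refine AddSubgroup.eq_bot_of_forall_prime fun p hp x hx ↦ ?_
    obtain ⟨p, rfl⟩ : ∃ q : Nat.Primes, (q : ℕ) = p := ⟨⟨p, hp⟩, rfl⟩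
    have hx0 (q : Nat.Primes) (χ : I q) : φ q χ x = 0 := congr($hx q χ)
    obtain ⟨y, rfl⟩ := exists_nsmul_eq_of_forall_zmod_hom hp.ne_zero
      (hI p x fun χ hχ ↦ by rw [← hφ p ⟨χ, hχ⟩, hx0, map_zero])
    refine ⟨y, ?_, rfl⟩
    funext q χ
    have h := hx0 q χ
    rw [map_nsmul] at h
    exact (smul_eq_zero.1 h).resolve_left hp.ne_zero
  have hsurj : Function.Surjective Φ := by
    rw [← AddMonoidHom.range_eq_top]
    refine AddSubgroup.eq_top_of_forall_prime (by simpa using (isCompact_range hΦ).isClosed)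
      fun p hp t ↦ ?_
    obtain ⟨p, rfl⟩ : ∃ q : Nat.Primes, (q : ℕ) = p := ⟨⟨p, hp⟩, rfl⟩
    obtain ⟨x, hx⟩ := hIv p fun χ ↦ PadicInt.toZMod (t p χ)
    have hdvd (q : Nat.Primes) (χ : I q) : ((p : ℕ) : ℤ_[(q : ℕ)]) ∣ t q χ - Φ x q χ := by
      rcases eq_or_ne q p with rfl | hq
      · rw [← Ideal.mem_span_singleton]
        rw [← PadicInt.maximalIdeal_eq_span_p, ← PadicInt.ker_toZMod, RingHom.mem_ker, map_sub,
          ← hx χ, sub_eq_zero]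
        exact (hφ _ χ x).symm
      · -- `p` is a unit in `ℤ_[q]`
        refine IsUnit.dvd (PadicInt.isUnit_iff.2 ?_)
        refine le_antisymm (PadicInt.norm_le_one _) (not_lt.1 fun h ↦ hq (Subtype.ext ?_))
        have h' := PadicInt.norm_int_lt_one_iff_dvd (p := (q : ℕ)) ((p : ℕ) : ℤ)
        rw [Int.cast_natCast] at h'
        exact (Nat.prime_dvd_prime_iff_eq q.2 hp).1 (by exact_mod_cast h'.1 h)
    choose y hy using hdvd
    refine ⟨y, x, ?_⟩
    funext q χ
    change _ = t q χ - (p : ℕ) • y q χ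
    rw [nsmul_eq_mul, ← hy q χ, sub_sub_cancel]
  exact ⟨ContinuousAddEquiv.mk'
    (hΦ.homeoOfEquivCompactToT2 (f := Equiv.ofBijective Φ ⟨hinj, hsurj⟩)) (map_add Φ)⟩

/-! ### Transport and basic examples of J-groups -/

lemma IsTopologicalJGroup.of_continuousMulEquiv {G H : Type*} [Group G] [TopologicalSpace G]
    [Group H] [TopologicalSpace H] [T2Space G] [IsTopologicalGroup G]
    (e : G ≃ₜ* H) (h : IsTopologicalJGroup H) : IsTopologicalJGroup G := by
  obtain ⟨w, f, h⟩ := h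
  refine ⟨e.symm w, fun x ↦ e.symm (f (e x)), inferInstance, inferInstance, ?_, fun x ↦ ?_⟩
  · exact e.symm.continuous.comp (h.continuous_map.comp e.continuous)
  · simp [h.map_mul_witness]

/-- On a product of groups of `p`-adic integers, `f x = x (x - 1) / 2` satisfies
`f (x + 1) = f x + x`. -/
lemma isTopologicalJGroup_pi_padicInt (I : Nat.Primes → Type*) :
    IsTopologicalJGroup (Multiplicative ((p : Nat.Primes) → I p → ℤ_[(p : ℕ)])) := by
  refine ⟨.ofAdd 1, fun x ↦ .ofAdd fun p i ↦ Ring.choose (x.toAdd p i) 2, inferInstance,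
    inferInstance, ?_, fun x ↦ ?_⟩
  · refine continuous_ofAdd.comp (continuous_pi fun p ↦ continuous_pi fun i ↦ ?_)
    exact (PadicInt.continuous_choose 2).comp
      ((continuous_apply i).comp ((continuous_apply p).comp continuous_toAdd))
  · refine Multiplicative.toAdd.injective (funext fun p ↦ funext fun i ↦ ?_)
    change Ring.choose (x.toAdd p i + 1) 2 = Ring.choose (x.toAdd p i) 2 + x.toAdd p i
    rw [Ring.choose_succ_succ, Ring.choose_one_right, add_comm]

/-! ### Torsion J-groups -/

/-- If `f (x w) = f x * x` and `w` has order `n`, then iterating gives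
`x ^ n * w ^ (n (n - 1) / 2) = 1` for all `x`. The case `x = 1` shows that `n` is odd, and then
`x ^ n = 1`. -/
lemma odd_orderOf_of_map_mul_witness {G : Type*} [CommGroup G] {w : G} (hw : IsOfFinOrder w)
    {f : G → G} (hf : ∀ x, f (x * w) = f x * x) (x : G) : Odd (orderOf x) := by
  have hiter (x : G) (n : ℕ) : f (x * w ^ n) = f x * (x ^ n * w ^ (n.choose 2)) := by
    induction n with
    | zero => simp
    | succ n ih =>
      rw [pow_succ w, ← mul_assoc, hf, ih, Nat.choose_succ_succ', Nat.choose_one_right, pow_add w,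
        pow_succ x]
      ac_rfl
  have hn (x : G) : x ^ orderOf w * w ^ ((orderOf w).choose 2) = 1 := by
    have h := hiter x (orderOf w)
    rw [pow_orderOf_eq_one, mul_one] at h
    exact left_eq_mul.1 h
  have hw1 : w ^ ((orderOf w).choose 2) = 1 := by simpa using hn 1
  have hodd : Odd (orderOf w) := by
    have hpos : 0 < orderOf w := hw.orderOf_pos
    obtain ⟨k, hk⟩ := orderOf_dvd_of_pow_eq_one hw1
    have h2 := Nat.choose_two_right (orderOf w)
    rw [hk] at h2
    have heven : 2 ∣ orderOf w * (orderOf w - 1) := (Nat.even_mul_pred_self _).two_dvd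
    have h3 : orderOf w * (2 * k) = orderOf w * (orderOf w - 1) := by
      rw [← Nat.div_mul_cancel heven, ← h2]; ring
    have h4 := Nat.eq_of_mul_eq_mul_left hpos h3
    exact ⟨k, by omega⟩
  refine hodd.of_dvd_nat (orderOf_dvd_of_pow_eq_one ?_)
  simpa [hw1] using hn x

/-- By Baire's theorem, a compact Hausdorff torsion group has finite exponent. -/
lemma exponentExists_of_isMulTorsion {G : Type*} [CommGroup G] [TopologicalSpace G]
    [IsTopologicalGroup G] [T2Space G] [CompactSpace G] (h : IsMulTorsion G) :
    Monoid.ExponentExists G := by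
  obtain ⟨n, x, hx⟩ := nonempty_interior_of_iUnion_of_closed
    (f := fun n : ℕ ↦ ((powMonoidHom (n + 1) : G →* G).ker : Set G))
    (fun n ↦ isClosed_singleton.preimage (continuous_pow (n + 1)))
    (Set.eq_univ_of_forall fun x ↦ by
      obtain ⟨n, hn, hx⟩ := isOfFinOrder_iff_pow_eq_one.1 (h x)
      exact Set.mem_iUnion.2 ⟨n - 1, by simpa [MonoidHom.mem_ker, Nat.sub_add_cancel hn] using hx⟩)
  set K := (powMonoidHom (n + 1) : G →* G).ker
  have hK : IsOpen (K : Set G) := K.isOpen_of_mem_nhds (mem_interior_iff_mem_nhds.1 hx)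
  have : Finite (G ⧸ K) := K.quotient_finite_of_isOpen hK
  refine ⟨Nat.card (G ⧸ K) * (n + 1), Nat.mul_pos Nat.card_pos n.succ_pos, fun y ↦ ?_⟩
  have hy : y ^ Nat.card (G ⧸ K) ∈ K := by
    rw [← QuotientGroup.eq_one_iff, QuotientGroup.mk_pow]
    exact pow_card_eq_one'
  rw [pow_mul]
  exact hy

/-- In a profinite abelian group annihilated by `m`, a cyclic subgroup of order `m` is a
topological direct summand. -/
lemma exists_zmod_hom_apply_eq_one {A : Type*} [AddCommGroup A] [TopologicalSpace A]
    [IsTopologicalAddGroup A] [CompactSpace A] [TotallyDisconnectedSpace A] [T2Space A] {m : ℕ}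
    (hm : m ≠ 0) (hA : ∀ x : A, m • x = 0) {w : A} (hw : addOrderOf w = m) :
    ∃ π : A →ₜ+ ZMod m, π w = 1 := by
  have : NeZero m := ⟨hm⟩
  let i : ZMod m →+ A := ZMod.lift m ⟨zmultiplesHom A w, by simpa using hA w⟩
  have hi1 : i 1 = w := by
    simpa [i] using ZMod.lift_coe m ⟨zmultiplesHom A w, by simpa using hA w⟩ 1
  have hi : Function.Injective i := by
    rw [injective_iff_map_eq_zero]
    intro a ha
    obtain ⟨k, rfl⟩ := ZMod.natCast_zmod_surjective a
    rw [← nsmul_one, map_nsmul, hi1, ← addOrderOf_dvd_iff_nsmul_eq_zero, hw] at ha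
    exact (ZMod.natCast_eq_zero_iff k m).2 ha
  -- an open subgroup meeting the multiples of `w` trivially
  obtain ⟨V, hV, hVw⟩ := exists_isOpen_addSubgroup_subset (A := A) (W := (i '' {0}ᶜ)ᶜ)
    (((Set.toFinite _).isClosed.isOpen_compl).mem_nhds (by
      rintro ⟨a, ha, h0⟩
      exact ha (hi (h0.trans (map_zero i).symm))))
  obtain ⟨χ, hχ, hχV⟩ := exists_character_extension i V (zmodToAddCircle m) fun k hk ↦ by
    by_contra hne
    exact hVw hk ⟨k, fun h0 ↦ hne (by rw [Set.mem_singleton_iff.1 h0, map_zero]), rfl⟩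
  obtain ⟨π, hπ⟩ := exists_zmod_lift hm χ fun x ↦ by rw [← map_nsmul, hA, map_zero]
  refine ⟨⟨π, π.continuous_of_isOpen_le_ker hV fun v hv ↦ zmodToAddCircle_injective hm ?_⟩,
    zmodToAddCircle_injective hm ?_⟩
  · rw [hπ, hχV v hv, map_zero]
  · change zmodToAddCircle m (π w) = _
    rw [hπ, ← hi1, hχ]

/-- Let `m` be the exponent, `w` an element of order `m` and `π` a homomorphism to `ZMod m` with
`π w = 1`. As `m` is odd, `f x = π x • x - (π x (π x + 1) / 2) • w` makes sense; on `w`-multiples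
it is `k w ↦ (k (k - 1) / 2) w`. -/
lemma isTopologicalJGroup_of_odd_orderOf {G : Type*} [CommGroup G] [TopologicalSpace G]
    [IsTopologicalGroup G] [T2Space G] [CompactSpace G] [TotallyDisconnectedSpace G]
    (h : ∀ x : G, Odd (orderOf x)) : IsTopologicalJGroup G := by
  have hex : Monoid.ExponentExists G := exponentExists_of_isMulTorsion fun x ↦
    orderOf_pos_iff.1 (h x).pos
  obtain ⟨w, hw⟩ := Monoid.exists_orderOf_eq_exponent hex
  set m := Monoid.exponent G
  have hm : Odd m := hw ▸ h w
  have hA (x : Additive G) : m • x = 0 := Monoid.pow_exponent_eq_one x.toMul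
  obtain ⟨π, hπ⟩ := exists_zmod_hom_apply_eq_one (A := Additive G) hm.pos.ne' hA
    (w := .ofMul w) (by simpa using hw)
  let : Module (ZMod m) (Additive G) := AddCommGroup.zmodModule hA
  obtain ⟨r, hr⟩ := hm
  have h2 : (2 : ZMod m) * (r + 1) = 1 := by
    have : ((2 * r + 1 : ℕ) : ZMod m) = 0 := by rw [← hr, ZMod.natCast_self]
    push_cast at this
    linear_combination this
  let f (x : Additive G) : Additive G :=
    π x • x - (((r + 1 : ZMod m)) * (π x * (π x + 1))) • .ofMul w
  refine ⟨w, fun x ↦ (f (.ofMul x)).toMul, inferInstance, inferInstance, ?_, fun x ↦ ?_⟩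
  · have hsmul : Continuous fun q : ZMod m × Additive G ↦ q.1 • q.2 := by
      refine continuous_prod_of_discrete_left.2 fun a ↦ ?_
      obtain ⟨k, rfl⟩ := ZMod.intCast_surjective a
      simp only [Int.cast_smul_eq_zsmul]
      exact continuous_const_smul k
    have hπc : Continuous π := map_continuous π
    have hc : Continuous fun a : ZMod m ↦ ((r + 1 : ZMod m) * (a * (a + 1))) • Additive.ofMul w :=
      continuous_of_discreteTopology
    exact continuous_toMul.comp
      (((hsmul.comp (hπc.prodMk continuous_id)).sub (hc.comp hπc)).comp continuous_ofMul)
  · change f (.ofMul x + .ofMul w) = f (.ofMul x) + .ofMul x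
    simp only [f, map_add, hπ]
    generalize Additive.ofMul x = x
    generalize Additive.ofMul w = w
    have hcoef : (π x + 1) - (r + 1) * ((π x + 1) * (π x + 1 + 1)) =
        - ((r + 1) * (π x * (π x + 1))) := by
      linear_combination (-(π x + 1)) * h2
    have hsmul := congr($hcoef • w)
    rw [sub_smul, neg_smul, add_smul, one_smul] at hsmul
    rw [add_smul, one_smul, smul_add,
      show ∀ a b c : Additive G, a + b + (x + w) - c = a + x + (b + w - c) by intros; abel, hsmul]
    abel

/-! ### Abelian profinite groups -/

theorem theoremE (G : Type u) [CommGroup G] [TopologicalSpace G] [IsTopologicalGroup G]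
    [T2Space G] [CompactSpace G] [TotallyDisconnectedSpace G] :
    (IsMulTorsionFree G →
      IsTopologicalJGroup G ∧
        ∃ I : Nat.Primes → Type u,
          Nonempty (G ≃ₜ* Multiplicative ((p : Nat.Primes) → I p → ℤ_[(p : ℕ)]))) ∧
    (IsMulTorsion G →
      (IsTopologicalJGroup G ↔ ∀ x : G, Odd (orderOf x))) := by
  refine ⟨fun _ ↦ ?_, fun htors ↦ ⟨?_, isTopologicalJGroup_of_odd_orderOf⟩⟩
  · obtain ⟨I, ⟨e⟩⟩ := exists_continuousAddEquiv_pi_padicInt (Additive G)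
    let e' : G ≃ₜ* Multiplicative ((p : Nat.Primes) → I p → ℤ_[(p : ℕ)]) :=
      { toFun x := .ofAdd (e (.ofMul x))
        invFun y := (e.symm y.toAdd).toMul
        left_inv x := by simp
        right_inv y := by simp
        map_mul' x y := by simp
        continuous_toFun := continuous_ofAdd.comp (e.continuous.comp continuous_ofMul)
        continuous_invFun := continuous_toMul.comp (e.symm.continuous.comp continuous_toAdd) }
    exact ⟨.of_continuousMulEquiv e' (isTopologicalJGroup_pi_padicInt I), I, ⟨e'⟩⟩
  · rintro ⟨w, f, h⟩ x
    exact odd_orderOf_of_map_mul_witness (htors w) h.map_mul_witness x
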